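/- Let $X$ be an Archimedean (real) vector lattice and let $A\subseteq X$. Then $A$ is uo-bounded if and only if $A$ is dominable. Here a filter $\mathcal F$ on $X$ converges in order to $x$ if there is a net $u_\gamma\downarrow 0$ in $X$ such that for every $\gamma$ one has $\{y\in X: |y-x|\le u_\gamma\}\in\mathcal F$; it uo-converges (converges unboundedly in order) to $x$ if for every $u\in X_+$ the image of $\mathcal F$ under $y\mapsto |y-x|\wedge u$ converges in order to $0$. The set $A$ is uo-bounded if the filter generated by the sets $UA=\{ra: r\in U,\ a\in A\}$, where $U$ runs through the neighbourhoods of $0$ in $\mathbb R$, uo-converges to $0$ (equivalently, for every net $r_\gamma\to 0$ in $\mathbb R$, the net $(r_\gamma a)_{(\gamma,a)\in\Gamma\times A}$, ordered by the first component, uo-converges to $0$). The set $A$ is dominable if it is order bounded as a subset of the universal completion $X^u$ of $X$, that is, of the (unique up to isomorphism) order complete and laterally complete vector lattice that contains $X$ as an order dense vector sublattice. -/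

import Mathlib

open Filter Topology Set
open scoped Pointwise

universe u v

/-! Throughout, a (real) vector lattice is a type `X` with the instances
`[AddCommGroup X] [Lattice X] [IsOrderedAddMonoid X] [Module ℝ X] [IsOrderedModule ℝ X]`. -/

/-- A vector lattice is Archimedean if `inf_n (1/n) u = 0` for every `u ≥ 0`.
(Mathlib's `Archimedean` is a different notion for groups that are not totally ordered.) -/
def IsArchimedeanVL (X : Type u) [AddCommGroup X] [Lattice X] [Module ℝ X] : Prop :=
  ∀ w : X, 0 ≤ w → IsGLB (Set.range fun n : ℕ => ((n : ℝ) + 1)⁻¹ • w) 0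

/-! ### Convergence structures

A convergence on `X` is given as a relation `F → x` between filters `F` on `X` and points `x`;
a net converges to `x` iff its tail filter (`Filter.map f atTop`) does. -/

section Convergence

variable {X : Type u} [AddCommGroup X] [Lattice X]

/-- Order convergence: there is a net `u_γ ↓ 0` such that, for every `γ`, eventually
`|y - x| ≤ u_γ`. The decreasing net is given by its range, a non-empty downward directed
set with infimum `0`. -/
def OrderConverges (F : Filter X) (x : X) : Prop :=
  ∃ D : Set X, D.Nonempty ∧ DirectedOn (· ≥ ·) D ∧ IsGLB D 0 ∧
    ∀ w ∈ D, ∀ᶠ y in F, |y - x| ≤ w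

/-- The unbounded modification of a convergence `η`:
`y_α → x` iff `|y_α - x| ∧ w → 0` with respect to `η` for every `w ≥ 0`. -/
def UnboundedModification (η : Filter X → X → Prop) (F : Filter X) (x : X) : Prop :=
  ∀ w : X, 0 ≤ w → η (F.map fun y => |y - x| ⊓ w) 0

/-- Unbounded order convergence (uo-convergence). -/
def UOConverges : Filter X → X → Prop :=
  UnboundedModification OrderConverges

/-- A set `A` is bounded with respect to a convergence `η` if the filter generated by the
sets `U • A`, where `U` runs through the neighbourhoods of `0` in `ℝ`, converges to `0`. -/
def IsConvergenceBounded [Module ℝ X] (η : Filter X → X → Prop) (A : Set X) : Prop :=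
  η (𝓝 (0 : ℝ) • 𝓟 A) 0

/-- A set is uo-bounded if it is bounded with respect to uo-convergence. -/
def IsUOBounded [Module ℝ X] (A : Set X) : Prop :=
  IsConvergenceBounded UOConverges A

end Convergence

/-! ### The universal completion -/

/-- Order (Dedekind) completeness: every non-empty set that is bounded above has a supremum. -/
def IsOrderComplete (Y : Type v) [Lattice Y] : Prop :=
  ∀ S : Set Y, S.Nonempty → BddAbove S → ∃ y, IsLUB S y

/-- Lateral completeness: every non-empty set of pairwise disjoint positive elements has
a supremum. -/
def IsLaterallyComplete (Y : Type v) [AddCommGroup Y] [Lattice Y] : Prop :=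
  ∀ S : Set Y, S.Nonempty → (∀ y ∈ S, 0 ≤ y) → S.Pairwise (fun y z => y ⊓ z = 0) →
    ∃ y, IsLUB S y

/-- A vector lattice is universally complete if it is order complete and laterally complete. -/
def IsUniversallyComplete (Y : Type v) [AddCommGroup Y] [Lattice Y] : Prop :=
  IsOrderComplete Y ∧ IsLaterallyComplete Y

/-- A universal completion of `X`: a universally complete vector lattice `carrier` together with
an embedding `ι` of `X` into it as an order dense vector sublattice. -/
structure UniversalCompletion (X : Type u) [AddCommGroup X] [Lattice X] [Module ℝ X] where
  carrier : Type u
  [addCommGroup : AddCommGroup carrier]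
  [lattice : Lattice carrier]
  [isOrderedAddMonoid : IsOrderedAddMonoid carrier]
  [module : Module ℝ carrier]
  [isOrderedModule : IsOrderedModule ℝ carrier]
  universallyComplete : IsUniversallyComplete carrier
  ι : X →ₗ[ℝ] carrier
  injective : Function.Injective ι
  map_sup : ∀ x y : X, ι (x ⊔ y) = ι x ⊔ ι y
  map_inf : ∀ x y : X, ι (x ⊓ y) = ι x ⊓ ι y
  orderDense : ∀ y : carrier, 0 < y → ∃ x : X, 0 < ι x ∧ ι x ≤ y

attribute [instance] UniversalCompletion.addCommGroup UniversalCompletion.lattice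
  UniversalCompletion.isOrderedAddMonoid UniversalCompletion.module
  UniversalCompletion.isOrderedModule

/-- A set `A` in `X` is dominable if it is order bounded as a subset of the universal completion
of `X`. (The universal completion of an Archimedean vector lattice exists and is unique up to a
lattice isomorphism that fixes `X`; with the existential quantifier, its existence is part of the
assertion that a set is dominable.) -/
def IsDominable {X : Type u} [AddCommGroup X] [Lattice X] [Module ℝ X] (A : Set X) : Prop :=
  ∃ U : UniversalCompletion X, BddBelow (U.ι '' A) ∧ BddAbove (U.ι '' A)

/-! A universal completion is built as a space of real functions modulo meagre sets, where order
boundedness of a family can be checked locally. Take a maximal disjoint system `E` of positive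
elements. The points of the space are decreasing sequences of positive elements below some `e ∈ E`;
basic open sets consist of the sequences eventually below a given `u`. A diagonal argument makes
this a Baire space. At a generic sequence each `x` has a real value relative to `e`, a Dedekind cut
read off from disjointness in `X`; the Archimedean property makes it finite. This embeds `X` as an
order dense sublattice of the germs, which are universally complete because locally bounded families
have suprema (`ResiduallyLocallyBddAbove.exists_lub`).

If `A` is uo-bounded, testing against `u` gives `ε > 0` and `d` with `u ≰ d` and `ε|a| ∧ u ≤ d` for
all `a ∈ A`. On the band of `(u - d)⁺`, which does not depend on `a`, this forces `|a| ≤ ε⁻¹ e`. So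
the moduli are locally bounded and have a supremum.

Conversely, let `|a| ≤ y` for all `a ∈ A` in any universal completion. The elements of `X` above
some `εy ∧ w` form a directed set that dominates `|ra| ∧ w`; its infimum in `X` is `0` by order
density (`le_of_forall_lower_bound`). -/

/-! ### Germs of Baire measurable functions -/

section BaireGerms

variable {T : Type u} [TopologicalSpace T]

/-- Real functions that are measurable with respect to the sets with the Baire property. -/
def IsBaireMeasurable (f : T → ℝ) : Prop :=
  @Measurable T ℝ (eventuallyMeasurableSpace (borel T) (residual T)) _ f

theorem isBaireMeasurable_of_lt {f : T → ℝ} (h : ∀ q, BaireMeasurableSet {p | q < f p}) :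
    IsBaireMeasurable f :=
  letI := eventuallyMeasurableSpace (borel T) (residual T)
  measurable_of_Ioi h

namespace IsBaireMeasurable

theorem baireMeasurableSet_preimage {f : T → ℝ} (hf : IsBaireMeasurable f) {s : Set ℝ}
    (hs : MeasurableSet s) : BaireMeasurableSet (f ⁻¹' s) :=
  hf hs

theorem zero : IsBaireMeasurable (0 : T → ℝ) :=
  letI := eventuallyMeasurableSpace (borel T) (residual T)
  measurable_const

theorem add {f g : T → ℝ} (hf : IsBaireMeasurable f) (hg : IsBaireMeasurable g) :
    IsBaireMeasurable (f + g) :=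
  letI := eventuallyMeasurableSpace (borel T) (residual T)
  Measurable.add hf hg

theorem const_smul {f : T → ℝ} (hf : IsBaireMeasurable f) (c : ℝ) :
    IsBaireMeasurable (c • f) :=
  letI := eventuallyMeasurableSpace (borel T) (residual T)
  Measurable.const_smul hf c

theorem sup {f g : T → ℝ} (hf : IsBaireMeasurable f) (hg : IsBaireMeasurable g) :
    IsBaireMeasurable (f ⊔ g) :=
  letI := eventuallyMeasurableSpace (borel T) (residual T)
  Measurable.sup hf hg

theorem inf {f g : T → ℝ} (hf : IsBaireMeasurable f) (hg : IsBaireMeasurable g) :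
    IsBaireMeasurable (f ⊓ g) :=
  letI := eventuallyMeasurableSpace (borel T) (residual T)
  Measurable.inf hf hg

end IsBaireMeasurable

theorem IsOpen.eq_empty_of_eventually_notMem [BaireSpace T] {W : Set T} (hW : IsOpen W)
    (h : ∀ᶠ p in residual T, p ∉ W) : W = ∅ := by
  by_contra hne
  obtain ⟨p, hp, hp'⟩ := (dense_of_mem_residual h).inter_open_nonempty W hW
    (nonempty_iff_ne_empty.2 hne)
  exact hp' hp

theorem BaireMeasurableSet.exists_isOpen_of_frequently {s W : Set T} (hs : BaireMeasurableSet s)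
    (hW : IsOpen W) (h : ∃ᶠ p in residual T, p ∈ s ∩ W) :
    ∃ W' ⊆ W, IsOpen W' ∧ W'.Nonempty ∧ ∀ᶠ p in residual T, p ∈ W' → p ∈ s := by
  obtain ⟨u, hu, hsu⟩ := hs.residualEq_isOpen
  rw [eventuallyEq_set] at hsu
  refine ⟨W ∩ u, inter_subset_left, hW.inter hu, ?_, ?_⟩
  · obtain ⟨p, ⟨hp, hpW⟩, hp'⟩ := (h.and_eventually hsu).exists
    exact ⟨p, hpW, hp'.1 hp⟩
  · filter_upwards [hsu] with p hp hpu using hp.2 hpu.2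

/-! ### Suprema of locally bounded families modulo meagre sets -/

/-- A family of functions is locally bounded above up to meagre sets. -/
def ResiduallyLocallyBddAbove (F : Set (T → ℝ)) : Prop :=
  ∀ W : Set T, IsOpen W → W.Nonempty → ∃ W' ⊆ W, IsOpen W' ∧ W'.Nonempty ∧
    ∃ c : ℝ, ∀ f ∈ F, ∀ᶠ p in residual T, p ∈ W' → f p ≤ c

/-- A pointwise supremum of uncountably many classes is not well defined. Replacing each `{q < f}`
by an open set equal to it up to a meagre set cures this: arbitrary unions `V q` of open sets are
open, and only countably many rationals `q` remain. -/
theorem ResiduallyLocallyBddAbove.exists_lub [BaireSpace T] {F : Set (T → ℝ)}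
    (hF : ∀ f ∈ F, IsBaireMeasurable f) (hne : F.Nonempty) (hloc : ResiduallyLocallyBddAbove F) :
    ∃ h : T → ℝ, IsBaireMeasurable h ∧ (∀ f ∈ F, f ≤ᶠ[residual T] h) ∧
      ∀ g : T → ℝ, IsBaireMeasurable g → (∀ f ∈ F, f ≤ᶠ[residual T] g) → h ≤ᶠ[residual T] g := by
  have hu : ∀ f : F, ∀ q : ℚ, ∃ u : Set T, IsOpen u ∧
      ∀ᶠ p in residual T, (q : ℝ) < f.1 p ↔ p ∈ u := fun f q => by
    obtain ⟨u, hu, hsu⟩ :=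
      ((hF f.1 f.2).baireMeasurableSet_preimage (measurableSet_Ioi (a := (q : ℝ)))).residualEq_isOpen
    exact ⟨u, hu, eventuallyEq_set.1 hsu⟩
  choose u huo hue using hu
  let V : ℚ → Set T := fun q => ⋃ f : F, u f q
  have hVo : ∀ q, IsOpen (V q) := fun q => isOpen_iUnion fun f => huo f q
  let S : T → Set ℝ := fun p => {r | ∃ q : ℚ, p ∈ V q ∧ (q : ℝ) = r}
  have hSne : ∀ᶠ p in residual T, (S p).Nonempty := by
    obtain ⟨f, hf⟩ := hne
    filter_upwards [eventually_countable_forall.2 (hue ⟨f, hf⟩)] with p hp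
    obtain ⟨q, hq⟩ := exists_rat_lt (f p)
    exact ⟨q, q, mem_iUnion.2 ⟨⟨f, hf⟩, (hp q).1 hq⟩, rfl⟩
  have hSb : ∀ᶠ p in residual T, BddAbove (S p) := by
    let B : Set T := ⋃₀ {W | IsOpen W ∧ ∃ c : ℝ, ∀ f ∈ F, ∀ᶠ p in residual T, p ∈ W → f p ≤ c}
    have hB : B ∈ residual T := by
      refine residual_of_dense_open (isOpen_sUnion fun W hW => hW.1) ?_
      rw [dense_iff_inter_open]
      intro W hW hWne
      obtain ⟨W', hW'W, hW'o, ⟨p, hp⟩, hc⟩ := hloc W hW hWne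
      exact ⟨p, hW'W hp, W', ⟨hW'o, hc⟩, hp⟩
    filter_upwards [hB] with p ⟨W, ⟨hWo, c, hc⟩, hpW⟩
    refine ⟨c, ?_⟩
    rintro _ ⟨q, hq, rfl⟩
    obtain ⟨f, hf⟩ := mem_iUnion.1 hq
    by_contra! hcq
    -- The two sets are disjoint only up to a meagre set, but both are open in a Baire space, so
    -- they are disjoint.
    have : u f q ∩ W = ∅ := by
      refine ((huo f q).inter hWo).eq_empty_of_eventually_notMem ?_
      filter_upwards [hc f f.2, hue f q] with p h1 h2 ⟨h3, h4⟩
      exact absurd (h2.2 h3) (not_lt.2 ((h1 h4).trans hcq.le))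
    exact (this ▸ ⟨hf, hpW⟩ : p ∈ (∅ : Set T))
  refine ⟨fun p => sSup (S p), isBaireMeasurable_of_lt fun r => ?_, fun f hf => ?_,
    fun g hg hfg => ?_⟩
  · have ho : IsOpen (⋃ q : {q : ℚ // r < q}, V q) := isOpen_iUnion fun q => hVo q
    refine ho.baireMeasurableSet.congr (eventuallyEq_set.2 ?_)
    filter_upwards [hSne, hSb] with p h1 h2
    rw [lt_csSup_iff h2 h1, mem_iUnion]
    constructor
    · rintro ⟨⟨q, hq⟩, hp⟩
      exact ⟨q, ⟨q, hp, rfl⟩, hq⟩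
    · rintro ⟨_, ⟨q, hp, rfl⟩, hq⟩
      exact ⟨⟨q, hq⟩, hp⟩
  · filter_upwards [hSb, eventually_countable_forall.2 (hue ⟨f, hf⟩)] with p h1 h2
    by_contra! hlt
    obtain ⟨q, hq, hqf⟩ := exists_rat_btwn hlt
    refine hq.not_ge ?_
    exact le_csSup h1 ⟨q, mem_iUnion.2 ⟨⟨f, hf⟩, (h2 q).1 hqf⟩, rfl⟩
  · have key : ∀ q : ℚ, ∀ᶠ p in residual T, p ∈ V q → (q : ℝ) ≤ g p := by
      intro q
      by_contra hcon
      -- If `g < q` on a non-meagre part of `V q`, then `g < q` almost everywhere on a nonempty open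
      -- piece, which meets some `u f q`, where `q < f ≤ g`.
      have hfr : ∃ᶠ p in residual T, p ∈ g ⁻¹' Iio (q : ℝ) ∩ V q := by
        rw [Filter.Frequently]
        refine fun h => hcon ?_
        filter_upwards [h] with p hp hpV
        by_contra! hlt
        exact hp ⟨hlt, hpV⟩
      obtain ⟨W, hWV, hWo, ⟨p, hp⟩, hW⟩ := (hg.baireMeasurableSet_preimage
        (measurableSet_Iio (a := (q : ℝ)))).exists_isOpen_of_frequently (hVo q) hfr
      obtain ⟨f, hf⟩ := mem_iUnion.1 (hWV hp)
      have : u f q ∩ W = ∅ := by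
        refine ((huo f q).inter hWo).eq_empty_of_eventually_notMem ?_
        filter_upwards [hW, hue f q, hfg f f.2] with p h1 h2 h3 ⟨h4, h5⟩
        exact absurd ((h2.2 h4).trans_le h3) (not_lt.2 (le_of_lt (h1 h5)))
      exact (this ▸ ⟨hf, hp⟩ : p ∈ (∅ : Set T))
    filter_upwards [hSne, eventually_countable_forall.2 key] with p h1 h2
    refine csSup_le h1 ?_
    rintro _ ⟨q, hq, rfl⟩
    exact h2 q hq

variable (T) in
/-- The Baire measurable real functions up to equality outside a meagre set. -/
def BaireGerm : Submodule ℝ (Germ (residual T) ℝ) where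
  carrier := {g | ∃ f : T → ℝ, IsBaireMeasurable f ∧ (f : Germ (residual T) ℝ) = g}
  add_mem' := by
    rintro _ _ ⟨f, hf, rfl⟩ ⟨g, hg, rfl⟩
    exact ⟨f + g, hf.add hg, rfl⟩
  zero_mem' := ⟨0, .zero, rfl⟩
  smul_mem' := by
    rintro c _ ⟨f, hf, rfl⟩
    exact ⟨c • f, hf.const_smul c, rfl⟩

namespace BaireGerm

instance instLattice : Lattice (BaireGerm T) :=
  Subtype.lattice
    (by rintro _ _ ⟨f, hf, rfl⟩ ⟨g, hg, rfl⟩; exact ⟨f ⊔ g, hf.sup hg, rfl⟩)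
    (by rintro _ _ ⟨f, hf, rfl⟩ ⟨g, hg, rfl⟩; exact ⟨f ⊓ g, hf.inf hg, rfl⟩)

instance instIsOrderedAddMonoid : IsOrderedAddMonoid (BaireGerm T) where
  add_le_add_left := fun a b h c => by
    have h' : (a : Germ (residual T) ℝ) ≤ b := h
    exact add_le_add_left h' (c : Germ (residual T) ℝ)

/-- The class of a Baire measurable function. -/
def mk (f : T → ℝ) (hf : IsBaireMeasurable f) : BaireGerm T := ⟨f, f, hf, rfl⟩

theorem exists_eq_mk (y : BaireGerm T) : ∃ f hf, y = mk f hf := by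
  obtain ⟨_, f, hf, rfl⟩ := y
  exact ⟨f, hf, rfl⟩

theorem mk_eq_mk {f g : T → ℝ} {hf : IsBaireMeasurable f} {hg : IsBaireMeasurable g} :
    mk f hf = mk g hg ↔ f =ᶠ[residual T] g :=
  Subtype.ext_iff.trans Germ.coe_eq

theorem mk_le_mk {f g : T → ℝ} {hf : IsBaireMeasurable f} {hg : IsBaireMeasurable g} :
    mk f hf ≤ mk g hg ↔ f ≤ᶠ[residual T] g :=
  Germ.coe_le

theorem mk_add_mk {f g : T → ℝ} (hf : IsBaireMeasurable f) (hg : IsBaireMeasurable g) :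
    mk f hf + mk g hg = mk (f + g) (hf.add hg) := rfl

theorem smul_mk {f : T → ℝ} (c : ℝ) (hf : IsBaireMeasurable f) :
    c • mk f hf = mk (c • f) (hf.const_smul c) := rfl

theorem mk_sup_mk {f g : T → ℝ} (hf : IsBaireMeasurable f) (hg : IsBaireMeasurable g) :
    mk f hf ⊔ mk g hg = mk (f ⊔ g) (hf.sup hg) := rfl

theorem mk_inf_mk {f g : T → ℝ} (hf : IsBaireMeasurable f) (hg : IsBaireMeasurable g) :
    mk f hf ⊓ mk g hg = mk (f ⊓ g) (hf.inf hg) := rfl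

theorem zero_eq_mk : (0 : BaireGerm T) = mk 0 .zero := rfl

instance instIsOrderedModule : IsOrderedModule ℝ (BaireGerm T) where
  smul_le_smul_of_nonneg_left := by
    intro c hc a b hab
    obtain ⟨f, hf, rfl⟩ := exists_eq_mk a
    obtain ⟨g, hg, rfl⟩ := exists_eq_mk b
    simp only [smul_mk, mk_le_mk] at hab ⊢
    filter_upwards [hab] with p hp using mul_le_mul_of_nonneg_left hp hc
  smul_le_smul_of_nonneg_right := by
    intro a ha c d hcd
    obtain ⟨f, hf, rfl⟩ := exists_eq_mk a
    rw [zero_eq_mk, mk_le_mk] at ha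
    change c • mk f hf ≤ d • mk f hf
    rw [smul_mk, smul_mk, mk_le_mk]
    filter_upwards [ha] with p hp using mul_le_mul_of_nonneg_right hcd hp

/-- The sets `{f ≤ n}` cover the space, so one of them meets `s ∩ W` in a non-meagre set. -/
theorem exists_isOpen_le_nat {f : T → ℝ} (hf : IsBaireMeasurable f) {s W : Set T}
    (hs : BaireMeasurableSet s) (hW : IsOpen W) (h : ∃ᶠ p in residual T, p ∈ s ∩ W) :
    ∃ W' ⊆ W, IsOpen W' ∧ W'.Nonempty ∧
      ∃ n : ℕ, ∀ᶠ p in residual T, p ∈ W' → p ∈ s ∧ f p ≤ n := by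
  have : ∃ n : ℕ, ∃ᶠ p in residual T, p ∈ (s ∩ f ⁻¹' Iic (n : ℝ)) ∩ W := by
    by_contra! hcon
    refine h ?_
    filter_upwards [eventually_countable_forall.2 hcon] with p hp hps
    obtain ⟨n, hn⟩ := exists_nat_ge (f p)
    exact hp n ⟨⟨hps.1, hn⟩, hps.2⟩
  obtain ⟨n, hn⟩ := this
  obtain ⟨W', h1, h2, h3, h4⟩ := (hs.inter (hf.baireMeasurableSet_preimage
    (measurableSet_Iic (a := (n : ℝ))))).exists_isOpen_of_frequently hW hn
  exact ⟨W', h1, h2, h3, n, h4⟩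

variable [BaireSpace T]

theorem exists_isLUB {S : Set (BaireGerm T)} (hne : S.Nonempty)
    (hloc : ResiduallyLocallyBddAbove {f : T → ℝ | ∃ hf, mk f hf ∈ S}) : ∃ y, IsLUB S y := by
  obtain ⟨h, hh, hub, hlub⟩ := hloc.exists_lub (fun f hf => hf.1) (by
    obtain ⟨y, hy⟩ := hne
    obtain ⟨f, hf, rfl⟩ := exists_eq_mk y
    exact ⟨f, hf, hy⟩)
  refine ⟨mk h hh, fun y hy => ?_, fun z hz => ?_⟩
  · obtain ⟨f, hf, rfl⟩ := exists_eq_mk y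
    exact mk_le_mk.2 (hub f ⟨hf, hy⟩)
  · obtain ⟨g, hg, rfl⟩ := exists_eq_mk z
    exact mk_le_mk.2 (hlub g hg fun f ⟨hf, hfS⟩ => mk_le_mk.1 (hz hfS))

theorem isUniversallyComplete : IsUniversallyComplete (BaireGerm T) := by
  refine ⟨fun S hne hb => ?_, fun S hne hpos hdis => ?_⟩
  · obtain ⟨y, hy⟩ := hb
    obtain ⟨g, hg, rfl⟩ := exists_eq_mk y
    refine exists_isLUB hne fun W hW hWne => ?_
    obtain ⟨W', h1, h2, h3, n, h4⟩ := exists_isOpen_le_nat hg (s := univ)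
      isOpen_univ.baireMeasurableSet hW (by
        rw [Filter.Frequently]
        intro h
        simp only [univ_inter] at h
        exact hWne.ne_empty (hW.eq_empty_of_eventually_notMem h))
    refine ⟨W', h1, h2, h3, n, fun f ⟨hf, hfS⟩ => ?_⟩
    filter_upwards [h4, mk_le_mk.1 (hy hfS)] with p hp hfg hpW using hfg.trans (hp hpW).2
  · refine exists_isLUB hne fun W hW hWne => ?_
    -- Either `0` is a local bound, or some member is positive and bounded on an open piece; by
    -- disjointness all other members vanish almost everywhere there.
    by_cases hzero : ∀ f : T → ℝ, (∃ hf, mk f hf ∈ S) → ∀ᶠ p in residual T, p ∈ W → f p ≤ 0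
    · exact ⟨W, subset_rfl, hW, hWne, 0, hzero⟩
    push Not at hzero
    obtain ⟨f, ⟨hf, hfS⟩, hfW⟩ := hzero
    obtain ⟨W', h1, h2, h3, n, h4⟩ := exists_isOpen_le_nat hf
      (hf.baireMeasurableSet_preimage (measurableSet_Ioi (a := (0 : ℝ)))) hW (by
        simpa [and_comm] using hfW)
    refine ⟨W', h1, h2, h3, n, fun g ⟨hg, hgS⟩ => ?_⟩
    by_cases hfg : mk g hg = mk f hf
    · filter_upwards [h4, mk_eq_mk.1 hfg] with p hp hpfg hpW
      exact hpfg ▸ (hp hpW).2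
    · have := hdis hgS hfS hfg
      simp only [mk_inf_mk, zero_eq_mk, mk_eq_mk] at this
      filter_upwards [h4, this] with p hp hpfg hpW
      have h5 : min (g p) (f p) = 0 := hpfg
      have h6 : 0 < f p := (hp hpW).1
      have : g p ≤ 0 := by
        by_contra! hgp
        exact (lt_min hgp h6).ne' h5
      exact this.trans n.cast_nonneg

end BaireGerm

end BaireGerms

/-! ### Disjointness in vector lattices -/

section Disjointness

variable {X : Type u} [AddCommGroup X] [Lattice X]

theorem inf_eq_zero_of_le_of_le {a a' b b' : X} (h : a ⊓ b = 0) (ha' : 0 ≤ a') (hb' : 0 ≤ b')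
    (ha : a' ≤ a) (hb : b' ≤ b) : a' ⊓ b' = 0 :=
  le_antisymm ((inf_le_inf ha hb).trans h.le) (le_inf ha' hb')

theorem posPart_pos_of_not_nonpos {x : X} (h : ¬ x ≤ 0) : 0 < x⁺ :=
  lt_of_le_of_ne (posPart_nonneg x) fun h0 => h (posPart_eq_zero.1 h0.symm)

theorem IsArchimedeanVL.exists_not_le [Module ℝ X] (hX : IsArchimedeanVL X) {u w : X}
    (hu : 0 < u) (hw : 0 ≤ w) : ∃ n : ℕ, ¬ u ≤ ((n : ℝ) + 1)⁻¹ • w := by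
  by_contra! h
  exact hu.not_ge ((hX w hw).2 (by rintro _ ⟨n, rfl⟩; exact h n))

theorem smul_posPart_le [Module ℝ X] [IsOrderedModule ℝ X] {c : ℝ} (hc : 0 ≤ c) (x : X) :
    (c • x)⁺ ≤ c • x⁺ :=
  sup_le (smul_le_smul_of_nonneg_left (le_posPart x) hc) (smul_nonneg hc (posPart_nonneg x))

theorem real_smul_pos [Module ℝ X] [IsOrderedModule ℝ X] {c : ℝ} (hc : 0 < c) {x : X}
    (hx : 0 < x) : 0 < c • x :=
  lt_of_le_of_ne (smul_nonneg hc.le hx.le) fun h =>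
    hx.ne' ((smul_eq_zero.1 h.symm).resolve_left hc.ne')

theorem abs_real_smul_le [Module ℝ X] [IsOrderedModule ℝ X] (c : ℝ) (x : X) :
    |c • x| ≤ |c| • |x| := by
  rcases le_total 0 c with hc | hc
  · rw [abs_of_nonneg hc]
    refine sup_le (smul_le_smul_of_nonneg_left (le_abs_self x) hc) ?_
    rw [← smul_neg]
    exact smul_le_smul_of_nonneg_left (neg_le_abs x) hc
  · rw [abs_of_nonpos hc]
    have hc' := neg_nonneg.2 hc
    refine sup_le ?_ ?_
    · rw [← neg_smul_neg]
      exact smul_le_smul_of_nonneg_left (neg_le_abs x) hc'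
    · rw [← neg_smul]
      exact smul_le_smul_of_nonneg_left (le_abs_self x) hc'

theorem real_smul_abs_le [Module ℝ X] [IsOrderedModule ℝ X] {c : ℝ} (hc : 0 < c) (x : X) :
    c • |x| ≤ |c • x| := by
  have h := smul_le_smul_of_nonneg_left (abs_real_smul_le c⁻¹ (c • x)) hc.le
  rwa [smul_smul, smul_smul, abs_of_pos (inv_pos.2 hc), inv_mul_cancel₀ hc.ne',
    mul_inv_cancel₀ hc.ne', one_smul, one_smul] at h

variable [IsOrderedAddMonoid X]

theorem inf_add_eq_zero {a b c : X} (ha : 0 ≤ a) (hb : 0 ≤ b) (hc : 0 ≤ c) (hab : a ⊓ b = 0)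
    (hac : a ⊓ c = 0) : a ⊓ (b + c) = 0 := by
  refine le_antisymm ?_ (le_inf ha (add_nonneg hb hc))
  have h1 : a ⊓ (b + c) - b ≤ a ⊓ c :=
    le_inf ((sub_le_self _ hb).trans inf_le_left) (sub_le_iff_le_add'.2 inf_le_right)
  rw [hac, sub_nonpos] at h1
  exact (le_inf inf_le_left h1).trans hab.le

theorem posPart_sub_inf_posPart_sub (a b : X) : (a - b)⁺ ⊓ (b - a)⁺ = 0 := by
  have := posPart_inf_negPart_eq_zero (a - b)
  rwa [← posPart_neg, neg_sub] at this

theorem posPart_add_le (a b : X) : (a + b)⁺ ≤ a⁺ + b⁺ :=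
  sup_le (add_le_add (le_posPart a) (le_posPart b)) (add_nonneg (posPart_nonneg a) (posPart_nonneg b))

variable [Module ℝ X] [IsOrderedModule ℝ X]

theorem inf_smul_eq_zero {a b : X} (ha : 0 ≤ a) (hb : 0 ≤ b) (hab : a ⊓ b = 0) {c : ℝ}
    (hc : 0 ≤ c) : a ⊓ c • b = 0 := by
  have hn : ∀ n : ℕ, a ⊓ n • b = 0 := fun n => by
    induction n with
    | zero => simpa using ha
    | succ n ih => rw [succ_nsmul]; exact inf_add_eq_zero ha (nsmul_nonneg hb n) hb ih hab
  obtain ⟨n, hcn⟩ := exists_nat_ge c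
  refine inf_eq_zero_of_le_of_le (hn n) ha (smul_nonneg hc hb) le_rfl ?_
  rw [← Nat.cast_smul_eq_nsmul ℝ]
  exact smul_le_smul_of_nonneg_right hcn hb

end Disjointness

/-! ### A Baire space attached to a maximal disjoint system -/

section Representation

variable {X : Type u} [AddCommGroup X] [Lattice X]

/-- A maximal set of pairwise disjoint positive elements. -/
structure IsUnitSystem (E : Set X) : Prop where
  pos : ∀ e ∈ E, 0 < e
  disjoint : E.Pairwise fun a b => a ⊓ b = 0
  total : ∀ x : X, 0 < x → ∃ e ∈ E, 0 < x ⊓ e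

theorem exists_isUnitSystem (X : Type u) [AddCommGroup X] [Lattice X] :
    ∃ E : Set X, IsUnitSystem E := by
  obtain ⟨E, hE⟩ := zorn_subset
    {E : Set X | (∀ e ∈ E, 0 < e) ∧ E.Pairwise fun a b => a ⊓ b = 0} fun c hc hchain => by
      refine ⟨⋃₀ c, ⟨fun e ⟨s, hs, he⟩ => (hc hs).1 e he, ?_⟩, fun s hs => subset_sUnion_of_mem hs⟩
      exact (pairwise_sUnion hchain.directedOn).2 fun s hs => (hc hs).2
  refine ⟨E, hE.prop.1, hE.prop.2, fun x hx => ?_⟩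
  by_contra! hcon
  have h0 : ∀ e ∈ E, x ⊓ e = 0 := fun e he => by
    by_contra hne
    exact hcon e he (lt_of_le_of_ne (le_inf hx.le (hE.prop.1 e he).le) (Ne.symm hne))
  have hins : insert x E ∈ {E : Set X | (∀ e ∈ E, 0 < e) ∧ E.Pairwise fun a b => a ⊓ b = 0} := by
    refine ⟨?_, hE.prop.2.insert fun e he _ => ⟨h0 e he, inf_comm e x ▸ h0 e he⟩⟩
    rintro e (rfl | he)
    exacts [hx, hE.prop.1 e he]
  have hxE : x ∈ E := hE.le_of_ge hins (subset_insert x E) (mem_insert x E)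
  exact hx.ne' (by simpa using h0 x hxE)

/-- The decreasing sequences of positive elements below some element of `E`. -/
structure DescSeq (E : Set X) where
  seq : ℕ → X
  unit : X
  antitone : Antitone seq
  pos : ∀ n, 0 < seq n
  unit_mem : unit ∈ E
  seq_le_unit : ∀ n, seq n ≤ unit

namespace DescSeq

variable {E : Set X}

/-- The sequences that are eventually below `u`. -/
def below (E : Set X) (u : X) : Set (DescSeq E) := {s | ∃ n, s.seq n ≤ u}

theorem below_mono {u v : X} (h : u ≤ v) : below E u ⊆ below E v :=
  fun _ ⟨n, hn⟩ => ⟨n, hn.trans h⟩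

/-- Whole sequences serve as points so that countably many successive refinements again define a
point. -/
instance : TopologicalSpace (DescSeq E) where
  IsOpen V := ∀ s ∈ V, ∃ n, below E (s.seq n) ⊆ V
  isOpen_univ := fun _ _ => ⟨0, subset_univ _⟩
  isOpen_inter := fun V W hV hW s ⟨hsV, hsW⟩ => by
    obtain ⟨n, hn⟩ := hV s hsV
    obtain ⟨m, hm⟩ := hW s hsW
    exact ⟨max n m, subset_inter ((below_mono (s.antitone (le_max_left n m))).trans hn)
      ((below_mono (s.antitone (le_max_right n m))).trans hm)⟩
  isOpen_sUnion := fun c hc s ⟨V, hV, hsV⟩ => by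
    obtain ⟨n, hn⟩ := hc V hV s hsV
    exact ⟨n, hn.trans (subset_sUnion_of_mem hV)⟩

theorem isOpen_iff {V : Set (DescSeq E)} : IsOpen V ↔ ∀ s ∈ V, ∃ n, below E (s.seq n) ⊆ V :=
  Iff.rfl

theorem isOpen_below (u : X) : IsOpen (below E u) :=
  isOpen_iff.2 fun _ ⟨n, hn⟩ => ⟨n, below_mono hn⟩

theorem below_nonempty {u e : X} (hu : 0 < u) (he : e ∈ E) (hue : u ≤ e) :
    (below E u).Nonempty :=
  ⟨⟨fun _ => u, e, antitone_const, fun _ => hu, he, fun _ => hue⟩, 0, le_rfl⟩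

theorem exists_below_subset {V : Set (DescSeq E)} (hV : IsOpen V) {s : DescSeq E} (hs : s ∈ V)
    {u : X} (hsu : s ∈ below E u) : ∃ v, 0 < v ∧ v ≤ u ∧ below E v ⊆ V := by
  obtain ⟨n, hn⟩ := hV s hs
  obtain ⟨m, hm⟩ := hsu
  exact ⟨s.seq (max n m), s.pos _, (s.antitone (le_max_right n m)).trans hm,
    (below_mono (s.antitone (le_max_left n m))).trans hn⟩

instance : BaireSpace (DescSeq E) where
  baire_property := fun V hVo hVd => by
    rw [dense_iff_inter_open]
    rintro W hW ⟨s, hs⟩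
    obtain ⟨k, hk⟩ := hW s hs
    have step : ∀ (n : ℕ) (v : {v : X // 0 < v ∧ v ≤ s.unit}),
        ∃ v' : {v : X // 0 < v ∧ v ≤ s.unit}, v'.1 ≤ v.1 ∧ below E v'.1 ⊆ V n := by
      rintro n ⟨v, hv0, hve⟩
      obtain ⟨p, hpv, hpV⟩ := (hVd n).inter_open_nonempty _ (isOpen_below v)
        (below_nonempty hv0 s.unit_mem hve)
      obtain ⟨v', h1, h2, h3⟩ := exists_below_subset (hVo n) hpV hpv
      exact ⟨⟨v', h1, h2.trans hve⟩, h2, h3⟩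
    choose F hF1 hF2 using step
    -- The refinements `a n`, with `below E (a (n + 1)) ⊆ V n`, are themselves a point of the space,
    -- and it lies in every `V n`.
    let a : ℕ → {v : X // 0 < v ∧ v ≤ s.unit} :=
      fun n => Nat.rec ⟨s.seq k, s.pos k, s.seq_le_unit k⟩ F n
    refine ⟨⟨fun n => (a n).1, s.unit, antitone_nat_of_succ_le fun n => hF1 n (a n),
      fun n => (a n).2.1, s.unit_mem, fun n => (a n).2.2⟩, hk ⟨0, le_rfl⟩, ?_⟩
    exact mem_iInter.2 fun n => hF2 n (a n) ⟨n + 1, le_rfl⟩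

theorem unit_eq (hE : IsUnitSystem E) {s : DescSeq E} {u e : X} (hs : s ∈ below E u) (he : e ∈ E)
    (hue : u ≤ e) : s.unit = e := by
  obtain ⟨n, hn⟩ := hs
  by_contra hne
  exact ((s.pos n).trans_le (le_inf (s.seq_le_unit n) (hn.trans hue))).ne'
    (hE.disjoint s.unit_mem he hne)

/-- Genericity is reduced to a refinement statement in `X`: below every small `u > 0` some `v > 0`
guarantees the property. -/
theorem eventually_of_dense {Q : DescSeq E → Prop} (ho : IsOpen {s | Q s})
    (hd : ∀ e ∈ E, ∀ u, 0 < u → u ≤ e → ∃ v, 0 < v ∧ v ≤ u ∧ ∀ s ∈ below E v, Q s) :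
    ∀ᶠ s in residual (DescSeq E), Q s := by
  refine residual_of_dense_open ho ?_
  rw [dense_iff_inter_open]
  rintro W hW ⟨s, hs⟩
  obtain ⟨k, hk⟩ := hW s hs
  obtain ⟨v, hv0, hvu, hv⟩ := hd s.unit s.unit_mem (s.seq k) (s.pos k) (s.seq_le_unit k)
  obtain ⟨p, hp⟩ := below_nonempty hv0 s.unit_mem (hvu.trans (s.seq_le_unit k))
  exact ⟨p, hk (below_mono hvu hp), hv p hp⟩

/-! ### Forced lower bounds and values of vectors -/

variable [Module ℝ X]

/-- `x ≥ q • s.unit` holds on the band generated by some member of the sequence `s`. -/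
def Forces (s : DescSeq E) (x : X) (q : ℝ) : Prop := ∃ n, s.seq n ⊓ (q • s.unit - x)⁺ = 0

/-- The real number `t` is the value of `x` at `s`, relative to the unit of `s`. -/
def IsValue (s : DescSeq E) (x : X) (t : ℝ) : Prop :=
  (∀ q < t, s.Forces x q) ∧ ∀ q < -t, s.Forces (-x) q

theorem IsValue.neg {s : DescSeq E} {x : X} {t : ℝ} (h : s.IsValue x t) :
    s.IsValue (-x) (-t) :=
  ⟨h.2, by simpa using h.1⟩

theorem Forces.of_le_seq {s s' : DescSeq E} {x : X} {q : ℝ} {n m : ℕ} (h0 : s'.unit = s.unit)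
    (h1 : s'.seq m ≤ s.seq n) (h : s.seq n ⊓ (q • s.unit - x)⁺ = 0) : s'.Forces x q :=
  ⟨m, h0 ▸ inf_eq_zero_of_le_of_le h (s'.pos m).le (posPart_nonneg _) h1 le_rfl⟩

theorem forces_of_mem_below (hE : IsUnitSystem E) {v e x : X} {q : ℝ} (he : e ∈ E) (hve : v ≤ e)
    (hv : v ⊓ (q • e - x)⁺ = 0) {s : DescSeq E} (hs : s ∈ below E v) : s.Forces x q := by
  obtain rfl := unit_eq hE hs he hve
  obtain ⟨n, hn⟩ := hs
  exact ⟨n, inf_eq_zero_of_le_of_le hv (s.pos n).le (posPart_nonneg _) hn le_rfl⟩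

theorem isOpen_forces (hE : IsUnitSystem E) (x : X) (q : ℝ) :
    IsOpen {s : DescSeq E | s.Forces x q} := by
  rintro s ⟨n, hn⟩
  refine ⟨n, fun s' hs' => ?_⟩
  have := unit_eq hE hs' s.unit_mem (s.seq_le_unit n)
  obtain ⟨m, hm⟩ := hs'
  exact Forces.of_le_seq this hm hn

variable [IsOrderedAddMonoid X]

theorem Forces.mono_left {s : DescSeq E} {x y : X} {q : ℝ} (h : s.Forces x q) (hxy : x ≤ y) :
    s.Forces y q := by
  obtain ⟨n, hn⟩ := h
  exact ⟨n, inf_eq_zero_of_le_of_le hn (s.pos n).le (posPart_nonneg _) le_rfl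
    (posPart_mono (sub_le_sub_left hxy _))⟩

theorem Forces.exists_inf_eq_zero {s : DescSeq E} {x y : X} {q r : ℝ} (hx : s.Forces x q)
    (hy : s.Forces y r) : ∃ n, s.seq n ⊓ ((q • s.unit - x)⁺ + (r • s.unit - y)⁺) = 0 := by
  obtain ⟨n, hn⟩ := hx
  obtain ⟨m, hm⟩ := hy
  exact ⟨max n m, inf_add_eq_zero (s.pos _).le (posPart_nonneg _) (posPart_nonneg _)
    (inf_eq_zero_of_le_of_le hn (s.pos _).le (posPart_nonneg _)
      (s.antitone (le_max_left n m)) le_rfl)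
    (inf_eq_zero_of_le_of_le hm (s.pos _).le (posPart_nonneg _)
      (s.antitone (le_max_right n m)) le_rfl)⟩

theorem Forces.add {s : DescSeq E} {x y : X} {q r : ℝ} (hx : s.Forces x q) (hy : s.Forces y r) :
    s.Forces (x + y) (q + r) := by
  obtain ⟨n, hn⟩ := hx.exists_inf_eq_zero hy
  refine ⟨n, inf_eq_zero_of_le_of_le hn (s.pos n).le (posPart_nonneg _) le_rfl ?_⟩
  rw [add_smul, add_sub_add_comm]
  exact posPart_add_le _ _

theorem Forces.inf {s : DescSeq E} {x y : X} {q : ℝ} (hx : s.Forces x q) (hy : s.Forces y q) :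
    s.Forces (x ⊓ y) q := by
  obtain ⟨n, hn⟩ := hx.exists_inf_eq_zero hy
  refine ⟨n, inf_eq_zero_of_le_of_le hn (s.pos n).le (posPart_nonneg _) le_rfl ?_⟩
  refine sup_le ?_ (add_nonneg (posPart_nonneg _) (posPart_nonneg _))
  rw [sub_le_comm]
  refine le_inf ?_ ?_
  · rw [sub_le_comm]
    exact (le_posPart _).trans (le_add_of_nonneg_right (posPart_nonneg _))
  · rw [sub_le_comm]
    exact (le_posPart _).trans (le_add_of_nonneg_left (posPart_nonneg _))

theorem IsValue.add {s : DescSeq E} {x y : X} {t t' : ℝ} (h : s.IsValue x t)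
    (h' : s.IsValue y t') : s.IsValue (x + y) (t + t') := by
  constructor
  · intro q hq
    have := (h.1 (t - (t + t' - q) / 2) (by linarith)).add
      (h'.1 (t' - (t + t' - q) / 2) (by linarith))
    rwa [show t - (t + t' - q) / 2 + (t' - (t + t' - q) / 2) = q by ring] at this
  · intro q hq
    have := (h.2 (-t - (-t - t' - q) / 2) (by linarith)).add
      (h'.2 (-t' - (-t - t' - q) / 2) (by linarith))
    rwa [show -t - (-t - t' - q) / 2 + (-t' - (-t - t' - q) / 2) = q by ring, ← neg_add] at this

theorem IsValue.sup {s : DescSeq E} {x y : X} {t t' : ℝ} (h : s.IsValue x t)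
    (h' : s.IsValue y t') : s.IsValue (x ⊔ y) (t ⊔ t') := by
  constructor
  · intro q hq
    rcases lt_max_iff.1 hq with hq | hq
    · exact (h.1 q hq).mono_left le_sup_left
    · exact (h'.1 q hq).mono_left le_sup_right
  · intro q hq
    rw [neg_sup]
    rw [← min_neg_neg, lt_min_iff] at hq
    exact (h.2 q hq.1).inf (h'.2 q hq.2)

theorem eventually_forces_or (hE : IsUnitSystem E) (x : X) (q : ℝ) :
    ∀ᶠ s in residual (DescSeq E), s.Forces x q ∨ s.Forces (-x) (-q) := by
  refine eventually_of_dense ((isOpen_forces hE x q).union (isOpen_forces hE (-x) (-q)))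
    fun e he u hu hue => ?_
  -- If `u` is not disjoint from `(q • e - x)⁺`, their infimum is a refinement disjoint from `(x - q
  -- • e)⁺`.
  by_cases h : u ⊓ (q • e - x)⁺ = 0
  · exact ⟨u, hu, le_rfl, fun s hs => Or.inl (forces_of_mem_below hE he hue h hs)⟩
  · refine ⟨u ⊓ (q • e - x)⁺, lt_of_le_of_ne (le_inf hu.le (posPart_nonneg _)) (Ne.symm h),
      inf_le_left, fun s hs => Or.inr (forces_of_mem_below hE he (inf_le_left.trans hue) ?_ hs)⟩
    have := posPart_sub_inf_posPart_sub (q • e) x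
    refine inf_eq_zero_of_le_of_le this (le_inf hu.le (posPart_nonneg _)) (posPart_nonneg _)
      inf_le_right ?_
    rw [neg_smul, sub_neg_eq_add, neg_add_eq_sub]

variable [IsOrderedModule ℝ X]

theorem Forces.mono_right (hE : IsUnitSystem E) {s : DescSeq E} {x : X} {q r : ℝ}
    (h : s.Forces x q) (hrq : r ≤ q) : s.Forces x r := by
  obtain ⟨n, hn⟩ := h
  exact ⟨n, inf_eq_zero_of_le_of_le hn (s.pos n).le (posPart_nonneg _) le_rfl (posPart_mono
    (sub_le_sub_right (smul_le_smul_of_nonneg_right hrq (hE.pos _ s.unit_mem).le) _))⟩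

theorem Forces.smul {s : DescSeq E} {x : X} {q c : ℝ} (h : s.Forces x q) (hc : 0 ≤ c) :
    s.Forces (c • x) (c * q) := by
  obtain ⟨n, hn⟩ := h
  refine ⟨n, inf_eq_zero_of_le_of_le (inf_smul_eq_zero (s.pos n).le (posPart_nonneg _) hn hc)
    (s.pos n).le (posPart_nonneg _) le_rfl ?_⟩
  rw [mul_smul, ← smul_sub]
  exact smul_posPart_le hc _

/-- Adding gives `0 ≥ (q + r)e` near `s`; if `q + r > 0`, rescaling makes a term of `s` disjoint
from `e`, although it lies below `e`. -/
theorem Forces.add_nonpos (hE : IsUnitSystem E) {s : DescSeq E} {x : X} {q r : ℝ}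
    (h : s.Forces x q) (h' : s.Forces (-x) r) : q + r ≤ 0 := by
  by_contra! hpos
  obtain ⟨n, hn⟩ := (h.add h').smul (inv_nonneg.2 hpos.le)
  rw [add_neg_cancel, smul_zero, sub_zero, inv_mul_cancel₀ hpos.ne', one_smul,
    posPart_eq_self.2 (hE.pos _ s.unit_mem).le, inf_eq_left.2 (s.seq_le_unit n)] at hn
  exact (s.pos n).ne' hn

theorem IsValue.le_of_forces (hE : IsUnitSystem E) {s : DescSeq E} {x : X} {t q : ℝ}
    (h : s.IsValue x t) (hq : s.Forces x q) : q ≤ t := by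
  by_contra! htq
  obtain ⟨r, hr1, hr2⟩ := exists_between (neg_lt_neg htq)
  have := hq.add_nonpos hE (h.2 r hr2)
  linarith

theorem IsValue.le_of_forces_neg (hE : IsUnitSystem E) {s : DescSeq E} {x : X} {t q : ℝ}
    (h : s.IsValue x t) (hq : s.Forces (-x) (-q)) : t ≤ q :=
  neg_le_neg_iff.1 (h.neg.le_of_forces hE hq)

theorem IsValue.unique (hE : IsUnitSystem E) {s : DescSeq E} {x : X} {t t' : ℝ}
    (h : s.IsValue x t) (h' : s.IsValue x t') : t = t' :=
  le_antisymm (le_of_forall_lt_imp_le_of_dense fun _ hq => h'.le_of_forces hE (h.1 _ hq))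
    (le_of_forall_lt_imp_le_of_dense fun _ hq => h.le_of_forces hE (h'.1 _ hq))

theorem IsValue.smul_of_pos {s : DescSeq E} {x : X} {t c : ℝ} (h : s.IsValue x t)
    (hc : 0 < c) : s.IsValue (c • x) (c * t) := by
  constructor
  · intro q hq
    have := (h.1 (c⁻¹ * q) (by rwa [inv_mul_lt_iff₀ hc])).smul hc.le
    rwa [mul_inv_cancel_left₀ hc.ne'] at this
  · intro q hq
    have := (h.2 (c⁻¹ * q) (by rwa [inv_mul_lt_iff₀ hc, mul_neg])).smul hc.le
    rwa [mul_inv_cancel_left₀ hc.ne', smul_neg] at this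

theorem IsValue.zero (hE : IsUnitSystem E) (s : DescSeq E) : s.IsValue (0 : X) 0 := by
  have h : ∀ q < (0 : ℝ), s.Forces (0 : X) q := fun q hq => ⟨0, by
    rw [sub_zero, posPart_eq_zero.2 (smul_nonpos_of_nonpos_of_nonneg hq.le (hE.pos _ s.unit_mem).le)]
    exact inf_eq_right.2 (s.pos 0).le⟩
  exact ⟨h, by simpa using h⟩

theorem IsValue.smul (hE : IsUnitSystem E) {s : DescSeq E} {x : X} {t : ℝ} (h : s.IsValue x t)
    (c : ℝ) : s.IsValue (c • x) (c * t) := by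
  rcases lt_trichotomy c 0 with hc | rfl | hc
  · simpa using (h.smul_of_pos (neg_pos.2 hc)).neg
  · simpa using IsValue.zero hE s
  · exact h.smul_of_pos hc

/-! #### Almost every sequence assigns a value to every vector -/

theorem eventually_exists_forces (hX : IsArchimedeanVL X) (hE : IsUnitSystem E) (x : X) :
    ∀ᶠ s in residual (DescSeq E), ∃ q, s.Forces x q := by
  refine eventually_of_dense (Q := fun s => ∃ q, s.Forces x q) ?_ fun e he u hu hue => ?_
  · have : {s : DescSeq E | ∃ q, s.Forces x q} = ⋃ q, {s | s.Forces x q} := by ext; simp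
    rw [this]
    exact isOpen_iUnion fun q => isOpen_forces hE x q
  obtain ⟨n, hn⟩ := hX.exists_not_le hu (abs_nonneg x)
  set c : ℝ := (n : ℝ) + 1
  have hc : 0 < c := by positivity
  -- On the band of this element `|x| ≤ c • u ≤ c • e`, so `x ≥ -c • e`.
  refine ⟨(u - c⁻¹ • |x|)⁺, posPart_pos_of_not_nonpos fun h => hn (sub_nonpos.1 h),
    sup_le (sub_le_self _ (smul_nonneg (inv_nonneg.2 hc.le) (abs_nonneg x))) hu.le,
    fun s hs => ⟨-c, forces_of_mem_below hE he ((sup_le (sub_le_self _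
      (smul_nonneg (inv_nonneg.2 hc.le) (abs_nonneg x))) hu.le).trans hue) ?_ hs⟩⟩
  have h1 := inf_smul_eq_zero (posPart_nonneg _) (posPart_nonneg _)
    (posPart_sub_inf_posPart_sub u (c⁻¹ • |x|)) hc.le
  refine inf_eq_zero_of_le_of_le h1 (posPart_nonneg _) (posPart_nonneg _) le_rfl ?_
  refine sup_le ?_ (smul_nonneg hc.le (posPart_nonneg _))
  refine le_trans ?_ (smul_le_smul_of_nonneg_left (le_posPart _) hc.le)
  rw [smul_sub, smul_smul, mul_inv_cancel₀ hc.ne', one_smul, neg_smul, sub_eq_add_neg,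
    sub_eq_add_neg, add_comm]
  exact add_le_add (neg_le_abs x) (neg_le_neg (smul_le_smul_of_nonneg_left hue hc.le))

open Classical in
/-- The value of `x` at `s`, or zero if there is none. -/
noncomputable def value (x : X) (s : DescSeq E) : ℝ :=
  if h : ∃ t, s.IsValue x t then h.choose else 0

theorem IsValue.value_eq (hE : IsUnitSystem E) {s : DescSeq E} {x : X} {t : ℝ}
    (h : s.IsValue x t) : value x s = t := by
  have h' : ∃ t, s.IsValue x t := ⟨t, h⟩
  rw [value, dif_pos h']
  exact h'.choose_spec.unique hE h

theorem eventually_isValue (hX : IsArchimedeanVL X) (hE : IsUnitSystem E) (x : X) :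
    ∀ᶠ s in residual (DescSeq E), s.IsValue x (value x s) := by
  filter_upwards [eventually_exists_forces hX hE x, eventually_exists_forces hX hE (-x),
    eventually_countable_forall.2 fun q : ℚ => eventually_forces_or hE x q] with s h1 h2 h3
  suffices h : ∃ t, s.IsValue x t by
    obtain ⟨t, ht⟩ := h
    rwa [ht.value_eq hE]
  obtain ⟨r, hr⟩ := h2
  have hb : BddAbove {q | s.Forces x q} := ⟨-r, fun q hq => by
    have := Forces.add_nonpos hE hq hr
    linarith⟩
  -- The value is the cut of forced lower bounds. A rational strictly above it is not forced, so its
  -- negative is forced for `-x`; this uses only countably many generic conditions.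
  refine ⟨sSup {q | s.Forces x q}, fun q hq => ?_, fun q hq => ?_⟩
  · obtain ⟨q', hq', hlt⟩ := exists_lt_of_lt_csSup h1 hq
    exact Forces.mono_right hE hq' hlt.le
  · obtain ⟨q', h4, h5⟩ := exists_rat_btwn (lt_neg.1 hq)
    refine Forces.mono_right hE ((h3 q').resolve_left fun h => ?_) (le_neg.1 h5.le)
    exact (le_csSup hb h).not_gt h4

theorem isBaireMeasurable_value (hX : IsArchimedeanVL X) (hE : IsUnitSystem E) (x : X) :
    IsBaireMeasurable (value x : DescSeq E → ℝ) := by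
  refine isBaireMeasurable_of_lt fun q => ?_
  have ho : IsOpen (⋃ r : {r : ℝ // q < r}, {s : DescSeq E | s.Forces x r}) :=
    isOpen_iUnion fun r => isOpen_forces hE x r
  refine ho.baireMeasurableSet.congr (eventuallyEq_set.2 ?_)
  filter_upwards [eventually_isValue hX hE x] with s hs
  rw [mem_iUnion]
  constructor
  · rintro ⟨⟨r, hqr⟩, hr⟩
    exact hqr.trans_le (hs.le_of_forces hE hr)
  · intro h
    obtain ⟨r, h1, h2⟩ := exists_between (show q < value x s from h)
    exact ⟨⟨r, h1⟩, hs.1 r h2⟩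

/-- A generic sequence is either eventually below `u` or has a term disjoint from `u`. -/
theorem eventually_value_eq_zero_of_notMem_below (hE : IsUnitSystem E) {u : X}
    (hu : 0 ≤ u) :
    ∀ᶠ s in residual (DescSeq E), s ∉ below E u → value u s = 0 := by
  have h : ∀ᶠ s in residual (DescSeq E), s ∈ below E u ∪ {s | ∃ n, s.seq n ⊓ u = 0} := by
    refine eventually_of_dense ((isOpen_below u).union ?_) fun e he w hw hwe => ?_
    · rintro s ⟨n, hn⟩
      exact ⟨n, fun s' ⟨m, hm⟩ => ⟨m, inf_eq_zero_of_le_of_le hn (s'.pos m).le hu hm le_rfl⟩⟩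
    · by_cases h0 : w ⊓ u = 0
      · exact ⟨w, hw, le_rfl, fun s ⟨m, hm⟩ =>
          Or.inr ⟨m, inf_eq_zero_of_le_of_le h0 (s.pos m).le hu hm le_rfl⟩⟩
      · exact ⟨w ⊓ u, lt_of_le_of_ne (le_inf hw.le hu) (Ne.symm h0), inf_le_left,
          fun s hs => Or.inl (below_mono inf_le_right hs)⟩
  filter_upwards [h] with s hs hsu
  obtain ⟨n, hn⟩ := hs.resolve_left hsu
  have he := (hE.pos _ s.unit_mem).le
  refine IsValue.value_eq hE ⟨fun q hq => ⟨n, ?_⟩, fun q hq => ⟨n, ?_⟩⟩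
  · rw [posPart_eq_zero.2]
    · exact inf_eq_right.2 (s.pos n).le
    · exact sub_nonpos.2 ((smul_nonpos_of_nonpos_of_nonneg hq.le he).trans hu)
  · refine inf_eq_zero_of_le_of_le hn (s.pos n).le (posPart_nonneg _) le_rfl (sup_le ?_ hu)
    rw [sub_neg_eq_add]
    exact add_le_of_nonpos_left (smul_nonpos_of_nonpos_of_nonneg (by linarith) he)

/-! ### The order dense embedding into germs -/

/-- The representation of an Archimedean vector lattice by germs of functions. -/
noncomputable def toBaireGerm (hX : IsArchimedeanVL X) (hE : IsUnitSystem E) :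
    X →ₗ[ℝ] BaireGerm (DescSeq E) where
  toFun x := BaireGerm.mk (value x) (isBaireMeasurable_value hX hE x)
  map_add' x y := by
    rw [BaireGerm.mk_add_mk, BaireGerm.mk_eq_mk]
    filter_upwards [eventually_isValue hX hE x, eventually_isValue hX hE y] with s h1 h2
    exact (h1.add h2).value_eq hE
  map_smul' c x := by
    rw [RingHom.id_apply, BaireGerm.smul_mk, BaireGerm.mk_eq_mk]
    filter_upwards [eventually_isValue hX hE x] with s h1
    exact (h1.smul hE c).value_eq hE

variable (hX : IsArchimedeanVL X) (hE : IsUnitSystem E)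

theorem toBaireGerm_apply (x : X) : toBaireGerm hX hE x =
    BaireGerm.mk (value x) (isBaireMeasurable_value hX hE x) := rfl

theorem toBaireGerm_sup (x y : X) :
    toBaireGerm hX hE (x ⊔ y) = toBaireGerm hX hE x ⊔ toBaireGerm hX hE y := by
  simp only [toBaireGerm_apply]
  rw [BaireGerm.mk_sup_mk, BaireGerm.mk_eq_mk]
  filter_upwards [eventually_isValue hX hE x, eventually_isValue hX hE y] with s h1 h2
  exact (h1.sup h2).value_eq hE

theorem toBaireGerm_inf (x y : X) :
    toBaireGerm hX hE (x ⊓ y) = toBaireGerm hX hE x ⊓ toBaireGerm hX hE y := by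
  have h1 := congrArg (toBaireGerm hX hE) (inf_add_sup x y)
  have h2 := inf_add_sup (toBaireGerm hX hE x) (toBaireGerm hX hE y)
  rw [map_add, map_add, toBaireGerm_sup, ← h2] at h1
  exact add_right_cancel h1

theorem toBaireGerm_nonneg {x : X} (hx : 0 ≤ x) : 0 ≤ toBaireGerm hX hE x := by
  rw [← map_zero (toBaireGerm hX hE), ← inf_eq_left, ← toBaireGerm_inf, inf_eq_left.2 hx]

theorem toBaireGerm_abs (x : X) : toBaireGerm hX hE |x| = |toBaireGerm hX hE x| := by
  rw [abs, toBaireGerm_sup, map_neg, abs]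

theorem toBaireGerm_ne_zero {x : X} (hx : 0 < x) : toBaireGerm hX hE x ≠ 0 := by
  obtain ⟨e, he, hxe⟩ := hE.total x hx
  obtain ⟨n, hn⟩ := hX.exists_not_le hxe (hE.pos e he).le
  set c : ℝ := ((n : ℝ) + 1)⁻¹
  have hc : 0 < c := by positivity
  -- On the band of `v` one has `x ≥ c • e`, so `x` has value at least `c` almost everywhere on
  -- `below E v`.
  set v := (x ⊓ e - c • e)⁺
  have hv : 0 < v := posPart_pos_of_not_nonpos fun h => hn (sub_nonpos.1 h)
  have hve : v ≤ e :=
    sup_le ((sub_le_self _ (smul_nonneg hc.le (hE.pos e he).le)).trans inf_le_right)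
      (hE.pos e he).le
  have hdis : v ⊓ (c • e - x)⁺ = 0 :=
    inf_eq_zero_of_le_of_le (posPart_sub_inf_posPart_sub (x ⊓ e) (c • e)) hv.le
      (posPart_nonneg _) le_rfl (posPart_mono (sub_le_sub_left inf_le_left _))
  intro h0
  rw [toBaireGerm_apply, BaireGerm.zero_eq_mk, BaireGerm.mk_eq_mk] at h0
  refine (below_nonempty hv he hve).ne_empty
    ((isOpen_below v).eq_empty_of_eventually_notMem ?_)
  filter_upwards [h0, eventually_isValue hX hE x] with s h1 h2 hs
  have h3 := h2.le_of_forces hE (forces_of_mem_below hE he hve hdis hs)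
  rw [h1] at h3
  exact hc.not_ge h3

theorem toBaireGerm_injective : Function.Injective (toBaireGerm hX hE) := by
  rw [injective_iff_map_eq_zero]
  intro x hx
  by_contra hne
  refine toBaireGerm_ne_zero hX hE (lt_of_le_of_ne (abs_nonneg x) fun h => hne ?_) (by rw [toBaireGerm_abs, hx, abs_zero])
  exact le_antisymm (h ▸ le_abs_self x) (neg_nonpos.1 (h ▸ neg_le_abs x))

theorem exists_toBaireGerm_pos_le {y : BaireGerm (DescSeq E)} (hy : 0 < y) :
    ∃ x : X, 0 < toBaireGerm hX hE x ∧ toBaireGerm hX hE x ≤ y := by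
  obtain ⟨f, hf, rfl⟩ := BaireGerm.exists_eq_mk y
  have hy0 := BaireGerm.mk_le_mk.1 (BaireGerm.zero_eq_mk (T := DescSeq E) ▸ hy.le)
  have h1 : ∃ n : ℕ, ∃ᶠ s in residual (DescSeq E),
      s ∈ f ⁻¹' Ioi ((n : ℝ) + 1)⁻¹ ∩ univ := by
    by_contra! hcon
    refine hy.not_ge ?_
    rw [BaireGerm.zero_eq_mk, BaireGerm.mk_le_mk]
    filter_upwards [eventually_countable_forall.2 hcon] with s hs
    by_contra! hpos
    obtain ⟨n, hn⟩ := exists_nat_one_div_lt (show 0 < f s from hpos)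
    exact hs n ⟨by simpa using hn, trivial⟩
  obtain ⟨n, hn⟩ := h1
  set c : ℝ := ((n : ℝ) + 1)⁻¹
  have hc : 0 < c := by positivity
  obtain ⟨W, -, hW, ⟨s, hs⟩, hWf⟩ := (hf.baireMeasurableSet_preimage
    (measurableSet_Ioi (a := c))).exists_isOpen_of_frequently isOpen_univ hn
  obtain ⟨k, hk⟩ := hW s hs
  set u := s.seq k
  have hu : 0 < u := s.pos k
  have hcu : 0 < c • u := real_smul_pos hc hu
  -- Almost everywhere, `c • u` has value at most `c < f` on `below E u`, since `u` is below the
  -- unit, and value `0 ≤ f` elsewhere.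
  refine ⟨c • u, lt_of_le_of_ne (toBaireGerm_nonneg hX hE hcu.le)
    (toBaireGerm_ne_zero hX hE hcu).symm, ?_⟩
  rw [toBaireGerm_apply, BaireGerm.mk_le_mk]
  filter_upwards [hy0, hWf, eventually_value_eq_zero_of_notMem_below hE hu.le,
    eventually_isValue hX hE u] with p h1 h2 h3 h4
  rw [(h4.smul hE c).value_eq hE]
  by_cases hp : p ∈ below E u
  · have h5 : value u p ≤ 1 := by
      refine h4.le_of_forces_neg hE (forces_of_mem_below hE s.unit_mem (s.seq_le_unit k) ?_ hp)
      rw [posPart_eq_zero.2]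
      · exact inf_eq_right.2 hu.le
      · rw [neg_smul, one_smul, sub_neg_eq_add, neg_add_eq_sub]
        exact sub_nonpos.2 (s.seq_le_unit k)
    have h6 : c < f p := h2 (hk hp)
    nlinarith
  · rw [h3 hp, mul_zero]
    exact h1

/-- The universal completion of an Archimedean vector lattice given by germs of functions. -/
noncomputable def universalCompletion : UniversalCompletion X where
  carrier := BaireGerm (DescSeq E)
  universallyComplete := BaireGerm.isUniversallyComplete
  ι := toBaireGerm hX hE
  injective := toBaireGerm_injective hX hE
  map_sup := toBaireGerm_sup hX hE
  map_inf := toBaireGerm_inf hX hE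
  orderDense _ := exists_toBaireGerm_pos_le hX hE

end DescSeq

end Representation

/-! ### Bounded sets and dominable sets -/

theorem eventually_nhds_zero_smul_principal {X : Type u} [AddCommGroup X] [Module ℝ X] {A : Set X}
    {P : X → Prop} : (∀ᶠ x in 𝓝 (0 : ℝ) • 𝓟 A, P x) ↔
      ∃ ε > 0, ∀ r : ℝ, |r| < ε → ∀ a ∈ A, P (r • a) := by
  have h : (∀ᶠ x in 𝓝 (0 : ℝ) • 𝓟 A, P x) ↔ ∀ᶠ r in 𝓝 (0 : ℝ), ∀ a ∈ A, P (r • a) := by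
    rw [← Filter.map₂_smul, ← map_prod_eq_map₂, eventually_map, eventually_prod_principal_iff]
  rw [h, Metric.eventually_nhds_iff]
  simp only [dist_zero_right, Real.norm_eq_abs]

/-- If `s` is the supremum of the multiples of `z`, shifting the index shows that `s - z` is also an
upper bound. -/
theorem IsOrderComplete.nonpos_of_nsmul_le {Y : Type u} [AddCommGroup Y] [Lattice Y]
    [IsOrderedAddMonoid Y] (hY : IsOrderComplete Y) {z y : Y} (h : ∀ n : ℕ, n • z ≤ y) :
    z ≤ 0 := by
  obtain ⟨s, hs⟩ := hY (range fun n : ℕ => n • z) (range_nonempty _)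
    ⟨y, by rintro _ ⟨n, rfl⟩; exact h n⟩
  have : s ≤ s - z := hs.2 (by
    rintro _ ⟨n, rfl⟩
    rw [le_sub_iff_add_le, ← succ_nsmul]
    exact hs.1 ⟨n + 1, rfl⟩)
  simpa using this

section VectorLattice

variable {X : Type u} [AddCommGroup X] [Lattice X] [Module ℝ X]

theorem isUOBounded_iff {A : Set X} : IsUOBounded A ↔ ∀ w : X, 0 ≤ w →
    ∃ D : Set X, D.Nonempty ∧ DirectedOn (· ≥ ·) D ∧ IsGLB D 0 ∧
      ∀ d ∈ D, ∃ ε > 0, ∀ r : ℝ, |r| < ε → ∀ a ∈ A, |(|r • a| ⊓ w)| ≤ d := by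
  simp only [IsUOBounded, IsConvergenceBounded, UOConverges, UnboundedModification,
    OrderConverges, eventually_map, sub_zero, eventually_nhds_zero_smul_principal]

/-! ### Dominable sets are uo-bounded -/

namespace UniversalCompletion

variable (U : UniversalCompletion X)

theorem map_le_map_iff {x y : X} : U.ι x ≤ U.ι y ↔ x ≤ y := by
  rw [← inf_eq_left, ← U.map_inf, U.injective.eq_iff, inf_eq_left]

theorem map_abs (x : X) : U.ι |x| = |U.ι x| := by
  rw [abs, U.map_sup, map_neg, abs]

theorem map_nonneg_iff {x : X} : 0 ≤ U.ι x ↔ 0 ≤ x := by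
  rw [← map_zero U.ι, U.map_le_map_iff]

variable {U} in
theorem le_of_forall_lower_bound [IsOrderedAddMonoid X] {v w : X} {z : U.carrier}
    (hzw : z ≤ U.ι w) (h : ∀ u : X, z ≤ U.ι u → v ≤ u) : U.ι v ≤ z := by
  by_contra hvz
  obtain ⟨x, hx0, hx⟩ := U.orderDense _
    (posPart_pos_of_not_nonpos fun h' => hvz (sub_nonpos.1 h'))
  refine hx0.not_ge (U.universallyComplete.1.nonpos_of_nsmul_le (y := U.ι w - z) fun n => ?_)
  -- If `n • x ≤ w - z`, then `w - n • x` lies above `z`, hence above `v`. So `n • x + (v - z)⁺ ≤ w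
  -- - z`, and `x ≤ (v - z)⁺` gives the next multiple.
  induction n with
  | zero => simpa using hzw
  | succ n ih =>
    have h1 := U.map_le_map_iff.2 (h (w - n • x) (by
      rw [map_sub, map_nsmul]
      exact le_sub_comm.1 ih))
    rw [map_sub, map_nsmul] at h1
    rw [succ_nsmul]
    refine (add_le_add_right hx _).trans ?_
    rw [posPart_def, add_sup, add_zero]
    refine sup_le ?_ ih
    rw [← add_sub_assoc, add_comm]
    exact sub_le_sub_right (le_sub_iff_add_le.1 h1) _

end UniversalCompletion

variable [IsOrderedAddMonoid X]

theorem IsDominable.isUOBounded {A : Set X} (hA : IsDominable A) : IsUOBounded A := by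
  obtain ⟨U, ⟨l, hl⟩, ⟨m, hm⟩⟩ := hA
  set y := |l| ⊔ |m|
  have hy0 : 0 ≤ y := (abs_nonneg l).trans le_sup_left
  have hy : ∀ a ∈ A, |U.ι a| ≤ y := fun a ha => sup_le
    ((hm (mem_image_of_mem _ ha)).trans ((le_abs_self m).trans le_sup_right))
    ((neg_le_neg (hl (mem_image_of_mem _ ha))).trans ((neg_le_abs l).trans le_sup_left))
  refine isUOBounded_iff.2 fun w hw =>
    ⟨{u | ∃ ε : ℝ, 0 < ε ∧ (ε • y) ⊓ U.ι w ≤ U.ι u}, ⟨w, 1, one_pos, inf_le_right⟩, ?_, ⟨?_, ?_⟩, ?_⟩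
  · rintro u₁ ⟨ε₁, h₁, hu₁⟩ u₂ ⟨ε₂, h₂, hu₂⟩
    refine ⟨u₁ ⊓ u₂, ⟨min ε₁ ε₂, lt_min h₁ h₂, ?_⟩, inf_le_left, inf_le_right⟩
    rw [U.map_inf]
    exact le_inf
      ((inf_le_inf_right _ (smul_le_smul_of_nonneg_right (min_le_left _ _) hy0)).trans hu₁)
      ((inf_le_inf_right _ (smul_le_smul_of_nonneg_right (min_le_right _ _) hy0)).trans hu₂)
  · rintro u ⟨ε, hε, hu⟩
    exact U.map_nonneg_iff.1 ((le_inf (smul_nonneg hε.le hy0) (U.map_nonneg_iff.2 hw)).trans hu)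
  · intro v hv
    have key : ∀ ε : ℝ, 0 < ε → U.ι v ≤ ε • y := fun ε hε =>
      (UniversalCompletion.le_of_forall_lower_bound inf_le_right
        fun u hu => hv ⟨ε, hε, hu⟩).trans inf_le_left
    rw [← U.map_le_map_iff, map_zero]
    refine U.universallyComplete.1.nonpos_of_nsmul_le (y := y) fun n => ?_
    have h1 : U.ι v ≤ ((n : ℝ) + 1)⁻¹ • y := key _ (by positivity)
    have h2 := smul_le_smul_of_nonneg_left h1 n.cast_nonneg (α := ℝ)
    rw [Nat.cast_smul_eq_nsmul, smul_smul] at h2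
    refine h2.trans ?_
    conv_rhs => rw [← one_smul ℝ y]
    refine smul_le_smul_of_nonneg_right ?_ hy0
    rw [← div_eq_mul_inv]
    exact div_le_one_of_le₀ (by linarith) (by positivity)
  · rintro u ⟨ε, hε, hu⟩
    refine ⟨ε, hε, fun r hr a ha => ?_⟩
    rw [abs_of_nonneg (le_inf (abs_nonneg _) hw), ← U.map_le_map_iff, U.map_inf, U.map_abs,
      map_smul]
    exact (inf_le_inf_right _ (((abs_real_smul_le _ _).trans (smul_le_smul_of_nonneg_right hr.le (abs_nonneg _))).trans
      (smul_le_smul_of_nonneg_left (hy a ha) hε.le))).trans hu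

/-! ### uo-bounded sets are dominable -/

variable [IsOrderedModule ℝ X]

theorem IsUOBounded.residuallyLocallyBddAbove (hX : IsArchimedeanVL X) {A : Set X}
    (hA : IsUOBounded A) {E : Set X} (hE : IsUnitSystem E) :
    ResiduallyLocallyBddAbove {f : DescSeq E → ℝ | ∃ hf,
      BaireGerm.mk f hf ∈ (fun a => DescSeq.toBaireGerm hX hE |a|) '' A} := by
  rintro W hW ⟨s, hs⟩
  obtain ⟨k, hk⟩ := hW s hs
  set u := s.seq k
  have hu : 0 < u := s.pos k
  have hue : u ≤ s.unit := s.seq_le_unit k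
  obtain ⟨D, -, -, hD, hDA⟩ := isUOBounded_iff.1 hA u hu.le
  obtain ⟨d, hd, hud⟩ : ∃ d ∈ D, ¬ u ≤ d := by
    by_contra! h
    exact hu.not_ge (hD.2 h)
  obtain ⟨δ, hδ, hδA⟩ := hDA d hd
  -- Halving meets the strict condition `|r| < δ`.
  set ε := δ / 2
  have hε : 0 < ε := half_pos hδ
  have hεA : ∀ a ∈ A, (ε • |a|) ⊓ u ≤ d := fun a ha => by
    have := hδA ε (by rw [abs_of_pos hε]; exact half_lt_self hδ) a ha
    exact (inf_le_inf_right u (real_smul_abs_le hε a)).trans ((le_abs_self _).trans this)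
  have hv : 0 < (u - d)⁺ := posPart_pos_of_not_nonpos fun h => hud (sub_nonpos.1 h)
  have hvu : (u - d)⁺ ≤ u := sup_le (sub_le_self _ (hD.1 hd)) hu.le
  refine ⟨DescSeq.below E (u - d)⁺, (DescSeq.below_mono hvu).trans hk, DescSeq.isOpen_below _,
    DescSeq.below_nonempty hv s.unit_mem (hvu.trans hue), ε⁻¹, ?_⟩
  rintro f ⟨hf, a, ha, hfa⟩
  -- This is `u - d ≤ u - u ∧ ε|a|`; on the band of the right-hand side `ε|a| ≤ u ≤ e`.
  have hva : (u - d)⁺ ≤ (u - ε • |a|)⁺ := by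
    refine sup_le ?_ (posPart_nonneg _)
    have := hεA a ha
    rw [inf_comm, inf_eq_sub_posPart_sub] at this
    exact sub_le_comm.1 this
  have hdis : (u - d)⁺ ⊓ (-ε⁻¹ • s.unit - -|a|)⁺ = 0 := by
    refine inf_eq_zero_of_le_of_le (inf_smul_eq_zero (posPart_nonneg _) (posPart_nonneg _)
      (posPart_sub_inf_posPart_sub u (ε • |a|)) (inv_nonneg.2 hε.le)) hv.le (posPart_nonneg _) hva ?_
    refine sup_le ?_ (smul_nonneg (inv_nonneg.2 hε.le) (posPart_nonneg _))
    refine le_trans ?_ (smul_le_smul_of_nonneg_left (le_posPart _) (inv_nonneg.2 hε.le))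
    rw [smul_sub, smul_smul, inv_mul_cancel₀ hε.ne', one_smul, neg_smul, sub_neg_eq_add,
      neg_add_eq_sub]
    exact sub_le_sub_left (smul_le_smul_of_nonneg_left hue (inv_nonneg.2 hε.le)) _
  filter_upwards [(BaireGerm.mk_eq_mk (hf := DescSeq.isBaireMeasurable_value hX hE |a|)).1 hfa,
    DescSeq.eventually_isValue hX hE |a|] with p h1 h2 hp
  rw [← h1]
  exact h2.le_of_forces_neg hE
    (DescSeq.forces_of_mem_below hE s.unit_mem (hvu.trans hue) hdis hp)

theorem IsUOBounded.isDominable (hX : IsArchimedeanVL X) {A : Set X} (hA : IsUOBounded A) :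
    IsDominable A := by
  obtain ⟨E, hE⟩ := exists_isUnitSystem X
  refine ⟨DescSeq.universalCompletion hX hE, ?_⟩
  rcases A.eq_empty_or_nonempty with rfl | hne
  · simp
  obtain ⟨y, hy⟩ := BaireGerm.exists_isLUB (hne.image _) (hA.residuallyLocallyBddAbove hX hE)
  have h : ∀ a ∈ A, |DescSeq.toBaireGerm hX hE a| ≤ y := fun a ha =>
    (DescSeq.toBaireGerm_abs hX hE a).symm.trans_le (hy.1 ⟨a, ha, rfl⟩)
  constructor
  · refine ⟨-y, ?_⟩
    rintro _ ⟨a, ha, rfl⟩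
    exact neg_le.1 ((neg_le_abs _).trans (h a ha))
  · refine ⟨y, ?_⟩
    rintro _ ⟨a, ha, rfl⟩
    exact (le_abs_self _).trans (h a ha)

end VectorLattice

theorem mainTheorem3 (X : Type u) [AddCommGroup X] [Lattice X] [IsOrderedAddMonoid X]
    [Module ℝ X] [IsOrderedModule ℝ X] (hX : IsArchimedeanVL X) (A : Set X) :
    IsUOBounded A ↔ IsDominable A :=
  ⟨fun h => h.isDominable hX, fun h => h.isUOBounded⟩
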